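/- Let $k$ be a field, $Q$ a finite quiver and $kQ$ its path algebra, with the paths of $Q$ (including those of length $0$) as a $k$-basis. Let $I$ be a two-sided ideal of $kQ$ that is generated by paths and admissible, i.e. $Q_{\ge t}\subseteq I\subseteq Q_{\ge 2}$ for some $t\ge 2$, where $Q_{\ge t}$ denotes the two-sided ideal generated by all paths of length $t$; so $\Lambda=kQ/I$ is a finite dimensional monomial algebra. Suppose that $\Lambda$ has finite global dimension, i.e. every finitely generated left $\Lambda$-module has finite projective dimension. Then for each oriented cycle $w=\alpha_1\cdots\alpha_t$ of $Q$ (a path of length $t\ge 1$ that ends at the vertex where it starts) there is $1\le i\le t$ such that the rotated cycle $w_i=\alpha_i\cdots\alpha_t\alpha_1\cdots\alpha_{i-1}$ lies in $I$. -/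

import Mathlib

open CategoryTheory

universe u v w

/-- A path of the quiver `V`, together with its two end points. -/
abbrev QuiverPath (V : Type v) [Quiver.{w} V] : Type (max v w) :=
  Σ a b : V, Quiver.Path a b

/-- The path algebra `kQ` of the quiver `Q` with set of vertices `V`: formal `k`-linear
combinations of the paths of `Q` (those of length `0` included). -/
def PathAlgebra (k : Type u) [Field k] (V : Type v) [Quiver.{w} V] : Type (max u v w) :=
  QuiverPath V →₀ k

namespace PathAlgebra

noncomputable section

variable {k : Type u} [Field k] {V : Type v} [Quiver.{w} V]

instance : AddCommGroup (PathAlgebra k V) := inferInstanceAs (AddCommGroup (QuiverPath V →₀ k))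

instance : Module k (PathAlgebra k V) := inferInstanceAs (Module k (QuiverPath V →₀ k))

/-- The basis element of `kQ` given by a path with its end points. -/
def basisPath (k : Type u) [Field k] {V : Type v} [Quiver.{w} V] (p : QuiverPath V) :
    PathAlgebra k V :=
  Finsupp.single p (1 : k)

/-- A path, viewed as an element of `kQ`. -/
def ofPath (k : Type u) [Field k] {V : Type v} [Quiver.{w} V] {a b : V} (p : Quiver.Path a b) :
    PathAlgebra k V :=
  basisPath k ⟨a, b, p⟩

open Classical in
/-- The product in `kQ` of two paths: first `p`, then `q`, if `p` ends where `q` starts,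
and `0` otherwise. -/
def pathMul (k : Type u) [Field k] {V : Type v} [Quiver.{w} V] (p q : QuiverPath V) :
    PathAlgebra k V :=
  if h : p.2.1 = q.1 then ofPath k ((p.2.2.cast rfl h).comp q.2.2) else 0

/-- The multiplication of `kQ`: the bilinear extension of `pathMul`. -/
def mulBilin (k : Type u) [Field k] (V : Type v) [Quiver.{w} V] :
    PathAlgebra k V →ₗ[k] PathAlgebra k V →ₗ[k] PathAlgebra k V :=
  Finsupp.linearCombination k fun p : QuiverPath V =>
    (Finsupp.linearCombination k fun q : QuiverPath V => pathMul k p q :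
      (QuiverPath V →₀ k) →ₗ[k] PathAlgebra k V)

instance : Mul (PathAlgebra k V) := ⟨fun x y => mulBilin k V x y⟩

/-- The unit of `kQ`: the sum of the paths of length `0`. -/
instance [Fintype V] : One (PathAlgebra k V) :=
  ⟨∑ a : V, ofPath k (Quiver.Path.nil : Quiver.Path a a)⟩

theorem mul_def (x y : PathAlgebra k V) : x * y = mulBilin k V x y := rfl

theorem one_def [Fintype V] :
    (1 : PathAlgebra k V) = ∑ a : V, ofPath k (Quiver.Path.nil : Quiver.Path a a) := rfl

theorem mulBilin_basis (p q : QuiverPath V) :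
    mulBilin k V (basisPath k p) (basisPath k q) = pathMul k p q := by
  unfold mulBilin basisPath
  erw [Finsupp.linearCombination_single, one_smul, Finsupp.linearCombination_single, one_smul]

theorem ofPath_mul {a b c : V} (p : Quiver.Path a b) (q : Quiver.Path b c) :
    ofPath k p * ofPath k q = ofPath k (p.comp q) := by
  rw [mul_def]
  unfold ofPath
  rw [mulBilin_basis]
  simp [pathMul, ofPath]

theorem ofPath_mul_of_ne {a b c d : V} (p : Quiver.Path a b) (q : Quiver.Path c d)
    (h : b ≠ c) : ofPath k p * ofPath k q = 0 := by
  rw [mul_def]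
  unfold ofPath
  rw [mulBilin_basis]
  simp [pathMul, h]

/-- `kQ` is spanned by the paths. -/
theorem induction_on {P : PathAlgebra k V → Prop} (x : PathAlgebra k V)
    (zero : P 0) (add : ∀ x y, P x → P y → P (x + y))
    (smul : ∀ (c : k) {a b : V} (p : Quiver.Path a b), P (c • ofPath k p)) : P x := by
  refine Finsupp.induction_linear (motive := P) x zero add ?_
  rintro ⟨a, b, p⟩ c
  have := smul c p
  unfold ofPath basisPath at this
  erw [Finsupp.smul_single, smul_eq_mul, mul_one] at this
  exact this

instance [Fintype V] : Ring (PathAlgebra k V) where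
  __ := (inferInstance : AddCommGroup (PathAlgebra k V))
  left_distrib x y z := by simp only [mul_def, map_add]
  right_distrib x y z := by simp only [mul_def, map_add, LinearMap.add_apply]
  zero_mul x := by simp only [mul_def, map_zero, LinearMap.zero_apply]
  mul_zero x := by simp only [mul_def, map_zero]
  mul_assoc x y z := by
    simp only [mul_def]
    induction x using induction_on with
    | zero => simp
    | add x x' hx hx' => simp only [map_add, LinearMap.add_apply, hx, hx']
    | smul c p =>
    induction y using induction_on with
    | zero => simp
    | add y y' hy hy' => simp only [map_add, LinearMap.add_apply, hy, hy']
    | smul d q =>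
    induction z using induction_on with
    | zero => simp
    | add z z' hz hz' => simp only [map_add, hz, hz']
    | @smul e a' b' r =>
    simp only [map_smul, LinearMap.smul_apply]
    congr 3
    simp only [← mul_def]
    rename_i a b a₁ b₁
    by_cases h : b = a₁
    · subst h
      by_cases h' : b₁ = a'
      · subst h'
        simp [ofPath_mul, Quiver.Path.comp_assoc]
      · rw [ofPath_mul, ofPath_mul_of_ne _ _ h', ofPath_mul_of_ne _ _ h']
        simp [mul_def]
    · rw [ofPath_mul_of_ne _ _ h]
      by_cases h' : b₁ = a'
      · subst h'
        rw [ofPath_mul, ofPath_mul_of_ne _ _ h]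
        simp [mul_def]
      · rw [ofPath_mul_of_ne _ _ h']
        simp [mul_def]
  one_mul x := by
    rw [mul_def]
    induction x using induction_on with
    | zero => simp
    | add x y hx hy => rw [map_add, hx, hy]
    | @smul c a b p =>
    rw [map_smul, one_def, map_sum, LinearMap.sum_apply]
    congr 1
    rw [Finset.sum_eq_single a]
    · rw [← mul_def, ofPath_mul, Quiver.Path.nil_comp]
    · intro i _ hi
      rw [← mul_def, ofPath_mul_of_ne _ _ hi]
    · simp
  mul_one x := by
    rw [mul_def]
    induction x using induction_on with
    | zero => simp
    | add x y hx hy => rw [map_add, LinearMap.add_apply, hx, hy]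
    | @smul c a b p =>
    rw [map_smul, LinearMap.smul_apply, one_def, map_sum]
    congr 1
    rw [Finset.sum_eq_single b]
    · rw [← mul_def, ofPath_mul, Quiver.Path.comp_nil]
    · intro i _ hi
      rw [← mul_def, ofPath_mul_of_ne _ _ hi.symm]
    · simp

instance [Fintype V] : Algebra k (PathAlgebra k V) :=
  Algebra.ofModule (fun c x y => by simp only [mul_def, map_smul, LinearMap.smul_apply])
    (fun c x y => by simp only [mul_def, map_smul])

/-- The two-sided ideal of `kQ` generated by all paths of length `t`. -/
def pathIdeal (k : Type u) [Field k] (V : Type v) [Quiver.{w} V] [Fintype V] (t : ℕ) :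
    TwoSidedIdeal (PathAlgebra k V) :=
  TwoSidedIdeal.span {x | ∃ (a b : V) (p : Quiver.Path a b), p.length = t ∧ x = ofPath k p}

/-- A two-sided ideal of `kQ` is admissible if it contains all paths of some length `t ≥ 2`
and lies in the ideal generated by the paths of length `2`. -/
def IsAdmissible [Fintype V] (I : TwoSidedIdeal (PathAlgebra k V)) : Prop :=
  ∃ t : ℕ, 2 ≤ t ∧ pathIdeal k V t ≤ I ∧ I ≤ pathIdeal k V 2

/-- A two-sided ideal of `kQ` is monomial if it is admissible and generated by paths;
then `kQ / I` is a monomial algebra. -/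
def IsMonomial [Fintype V] (I : TwoSidedIdeal (PathAlgebra k V)) : Prop :=
  IsAdmissible I ∧ ∃ S : Set (QuiverPath V), I = TwoSidedIdeal.span (basisPath k '' S)

end

end PathAlgebra

/-- A finite dimensional algebra `Λ` has finite global dimension if every finitely generated
left `Λ`-module has finite projective dimension. -/
def HasFiniteGlobalDimension (Λ : Type u) [Ring Λ] : Prop :=
  ∀ X : ModuleCat.{u} Λ, Module.Finite Λ X → projectiveDimension X < ⊤

/-- `IsRotation x i y`: for the closed path `x = α₁ ⋯ αₜ` and `1 ≤ i ≤ t`, the closed path `y`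
is the rotation `αᵢ ⋯ αₜ α₁ ⋯ αᵢ₋₁` of `x`. -/
def IsRotation {V : Type v} [Quiver.{w} V] {a b : V} (x : Quiver.Path a a) (i : ℕ)
    (y : Quiver.Path b b) : Prop :=
  ∃ (p : Quiver.Path a b) (q : Quiver.Path b a),
    p.length + 1 = i ∧ x = p.comp q ∧ y = q.comp p

/-! Suppose that no rotation of the cycle lies in `I`, and let `u` be one of its rotations. Walking
backwards around the cycle from `u` gives paths `p u = u' p` with `u'` again a rotation. Long paths
lie in `I`, so there is a first moment at which `p u` does; then no proper right factor of `p u`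
lies in `I`. Since `I` is spanned by paths, this minimality makes `Λ p` a direct summand of the left
annihilator of `u`, which is the kernel of `Λ → Λ u`. Hence `pd Λ p < pd Λ u` unless `Λ u` is
projective. The same path factored as `u' p` makes `Λ u'` a summand of the left annihilator of `p`.
So a finite `pd Λ u` descends from rotation to rotation until some `Λ u` is projective. That is
impossible, as `p u = 0` with `p` and `u` nonzero in `Λ`. The carrying lemmas are
`IsMonomial.exists_minimal_comp_mem`, `IsMonomial.projSuffix_mul` and
`hasProjectiveDimensionLT_cyclicModule`. -/

namespace Quiver.Path

/-! ### Factorizations and rotations of paths. -/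

variable {V : Type v} [Quiver.{w} V]

/-- Two factorizations of a path have a common refinement. -/
theorem exists_of_comp_eq_comp {a b b' : V} (p : Path a b) (p' : Path a b') :
    ∀ {c : V} (q : Path b c) (q' : Path b' c), p.comp q = p'.comp q' →
      (∃ r : Path b b', q = r.comp q' ∧ p' = p.comp r) ∨
        ∃ r : Path b' b, q' = r.comp q ∧ p = p'.comp r
  | _, q, nil, h => Or.inl ⟨q, rfl, h.symm⟩
  | _, nil, q', h => Or.inr ⟨q', rfl, h⟩
  | _, cons q e, cons q' e', h => by
    rw [comp_cons, comp_cons] at h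
    obtain rfl := obj_eq_of_cons_eq_cons h
    obtain rfl := eq_of_heq (hom_heq_of_cons_eq_cons h)
    rcases exists_of_comp_eq_comp p p' q q' (eq_of_heq (heq_of_cons_eq_cons h)) with
      ⟨r, rfl, hr⟩ | ⟨r, rfl, hr⟩
    · exact Or.inl ⟨r, rfl, hr⟩
    · exact Or.inr ⟨r, rfl, hr⟩

/-- `p.IsCyclicShift q`: the closed path `q` arises from the closed path `p` by moving an
initial segment of `p` to its end. -/
def IsCyclicShift {a b : V} (p : Path a a) (q : Path b b) : Prop :=
  ∃ (r : Path a b) (s : Path b a), p = r.comp s ∧ q = s.comp r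

theorem IsCyclicShift.length_eq {a b : V} {p : Path a a} {q : Path b b}
    (h : p.IsCyclicShift q) : q.length = p.length := by
  obtain ⟨r, s, rfl, rfl⟩ := h
  simp [add_comm]

theorem IsCyclicShift.rotate_arrow {a b c : V} {p : Path a a} {s : Path b c} {e : c ⟶ b}
    (h : p.IsCyclicShift (s.cons e)) : p.IsCyclicShift (e.toPath.comp s) := by
  obtain ⟨r, t, rfl, ht⟩ := h
  cases r with
  -- With nothing moved so far there is no last arrow to move back; `s` is moved instead.
  | nil =>
    rw [comp_nil] at ht
    subst ht
    exact ⟨s, e.toPath, by simp, rfl⟩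
  | cons r f =>
    rw [comp_cons] at ht
    obtain rfl := obj_eq_of_cons_eq_cons ht
    obtain rfl := eq_of_heq (hom_heq_of_cons_eq_cons ht)
    obtain rfl := eq_of_heq (heq_of_cons_eq_cons ht)
    exact ⟨r, e.toPath.comp t, by simp [← comp_toPath_eq_cons, comp_assoc],
      by rw [comp_assoc]⟩

end Quiver.Path

/-! ### Coefficients, and monomial ideals as spans of paths. -/

namespace PathAlgebra

noncomputable section

variable {k : Type u} [Field k] {V : Type v} [Quiver.{w} V]

/-- The coefficient of a path in an element of the path algebra. -/
def coeff (z : QuiverPath V) : PathAlgebra k V →ₗ[k] k :=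
  (Finsupp.lapply z : (QuiverPath V →₀ k) →ₗ[k] k)

theorem coeff_basisPath_self (z : QuiverPath V) : coeff z (basisPath k z) = 1 :=
  Finsupp.single_eq_same

theorem coeff_basisPath_of_ne {z z' : QuiverPath V} (h : z ≠ z') :
    coeff z (basisPath k z') = 0 :=
  Finsupp.single_eq_of_ne h

theorem exists_finset_eq_sum (x : PathAlgebra k V) :
    ∃ s : Finset (QuiverPath V), (∀ z, z ∈ s ↔ coeff z x ≠ 0) ∧
      x = ∑ z ∈ s, coeff z x • basisPath k z := by
  refine ⟨Finsupp.support x, fun z => Finsupp.mem_support_iff, ?_⟩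
  refine (Finsupp.sum_single (x : QuiverPath V →₀ k)).symm.trans ?_
  refine Finset.sum_congr rfl fun z _ => ?_
  exact (Finsupp.smul_single_one z _).symm

theorem coeff_mul_ofPath {a b c : V} (x : PathAlgebra k V) (q : Quiver.Path a b)
    (p : Quiver.Path b c) :
    coeff ⟨a, c, q.comp p⟩ (x * ofPath k p) = coeff ⟨a, b, q⟩ x := by
  induction x using induction_on with
  | zero => simp [mul_def]
  | add x y hx hy => rw [mul_def, map_add, LinearMap.add_apply, map_add, map_add, ← hx, ← hy]; rfl
  | @smul e a' b' r =>
    rw [mul_def, map_smul, LinearMap.smul_apply, map_smul, map_smul, ← mul_def]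
    congr 1
    by_cases h : b' = b
    · subst h
      rw [ofPath_mul]
      unfold ofPath
      by_cases h' : (⟨a, b', q⟩ : QuiverPath V) = ⟨a', b', r⟩
      · cases h'
        rw [coeff_basisPath_self, coeff_basisPath_self]
      · rw [coeff_basisPath_of_ne h', coeff_basisPath_of_ne]
        intro h''
        obtain rfl : a = a' := congrArg Sigma.fst h''
        simp at h''
        exact h' (by rw [h''])
    · rw [ofPath_mul_of_ne _ _ h, map_zero]
      refine (coeff_basisPath_of_ne fun h' => h ?_).symm
      exact (congrArg (fun z : QuiverPath V => z.2.1) h').symm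

theorem coeff_ofPath_mul {a b c : V} (x : PathAlgebra k V) (p : Quiver.Path a b)
    (q : Quiver.Path b c) :
    coeff ⟨a, c, p.comp q⟩ (ofPath k p * x) = coeff ⟨b, c, q⟩ x := by
  induction x using induction_on with
  | zero => simp [mul_def]
  | add x y hx hy => rw [mul_def, map_add, map_add, map_add, ← hx, ← hy]; rfl
  | @smul e a' b' r =>
    rw [mul_def, map_smul, map_smul, map_smul, ← mul_def]
    congr 1
    by_cases h : b = a'
    · subst h
      rw [ofPath_mul]
      unfold ofPath
      by_cases h' : (⟨b, c, q⟩ : QuiverPath V) = ⟨b, b', r⟩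
      · cases h'
        rw [coeff_basisPath_self, coeff_basisPath_self]
      · rw [coeff_basisPath_of_ne h', coeff_basisPath_of_ne]
        intro h''
        obtain rfl : c = b' := congrArg (fun z : QuiverPath V => z.2.1) h''
        simp at h''
        exact h' (by rw [h''])
    · rw [ofPath_mul_of_ne _ _ h, map_zero]
      refine (coeff_basisPath_of_ne fun h' => h ?_).symm
      exact (congrArg Sigma.fst h')

variable [Fintype V] {I : TwoSidedIdeal (PathAlgebra k V)}

theorem smul_mem (c : k) {x : PathAlgebra k V} (hx : x ∈ I) : c • x ∈ I := by
  rw [Algebra.smul_def]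
  exact I.mul_mem_left _ _ hx

theorem basisPath_mul_basisPath (p q : QuiverPath V) :
    basisPath k p * basisPath k q = 0 ∨ ∃ r, basisPath k p * basisPath k q = basisPath k r := by
  obtain ⟨a, b, p⟩ := p
  obtain ⟨c, d, q⟩ := q
  by_cases h : b = c
  · subst h
    exact Or.inr ⟨_, ofPath_mul p q⟩
  · exact Or.inl (ofPath_mul_of_ne p q h)

/-- The elements of the path algebra all of whose paths lie in `I`. -/
def pathSpan (I : TwoSidedIdeal (PathAlgebra k V)) : Submodule k (PathAlgebra k V) :=
  Submodule.span k {x | x ∈ I ∧ ∃ z, x = basisPath k z}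

theorem mul_mem_pathSpan_left (x y : PathAlgebra k V) (hy : y ∈ pathSpan I) :
    x * y ∈ pathSpan I := by
  induction x using induction_on with
  | zero => rw [zero_mul]; exact zero_mem _
  | add x x' hx hx' => rw [add_mul]; exact add_mem hx hx'
  | @smul c a b p =>
    rw [Algebra.smul_mul_assoc]
    refine Submodule.smul_mem _ _ ?_
    induction hy using Submodule.span_induction with
    | zero => rw [mul_zero]; exact zero_mem _
    | add x x' _ _ hx hx' => rw [mul_add]; exact add_mem hx hx'
    | smul d x _ hx => rw [Algebra.mul_smul_comm]; exact Submodule.smul_mem _ _ hx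
    | mem x hx =>
      obtain ⟨hx, z, rfl⟩ := hx
      rcases basisPath_mul_basisPath (k := k) ⟨a, b, p⟩ z with h | ⟨r, h⟩
      · unfold ofPath
        rw [h]
        exact zero_mem _
      · exact Submodule.subset_span ⟨I.mul_mem_left _ _ hx, r, h⟩

theorem mul_mem_pathSpan_right (x y : PathAlgebra k V) (hx : x ∈ pathSpan I) :
    x * y ∈ pathSpan I := by
  induction y using induction_on with
  | zero => rw [mul_zero]; exact zero_mem _
  | add x x' hx hx' => rw [mul_add]; exact add_mem hx hx'
  | @smul c a b p =>
    rw [Algebra.mul_smul_comm]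
    refine Submodule.smul_mem _ _ ?_
    induction hx using Submodule.span_induction with
    | zero => rw [zero_mul]; exact zero_mem _
    | add x x' _ _ hx hx' => rw [add_mul]; exact add_mem hx hx'
    | smul d x _ hx => rw [Algebra.smul_mul_assoc]; exact Submodule.smul_mem _ _ hx
    | mem x hx =>
      obtain ⟨hx, z, rfl⟩ := hx
      rcases basisPath_mul_basisPath (k := k) z ⟨a, b, p⟩ with h | ⟨r, h⟩
      · unfold ofPath
        rw [h]
        exact zero_mem _
      · exact Submodule.subset_span ⟨I.mul_mem_right _ _ hx, r, h⟩

theorem mem_pathSpan_of_mem_span {S : Set (QuiverPath V)}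
    (hS : I = TwoSidedIdeal.span (basisPath k '' S)) {x : PathAlgebra k V} (hx : x ∈ I) :
    x ∈ pathSpan I := by
  -- The span of the paths in `I` is itself a two-sided ideal and contains the generators, so it
  -- contains `I`.
  let J : TwoSidedIdeal (PathAlgebra k V) :=
    .mk' (pathSpan I) (zero_mem _) add_mem neg_mem
      (fun {x y} => mul_mem_pathSpan_left x y) (fun {x y} => mul_mem_pathSpan_right x y)
  have hJ : TwoSidedIdeal.span (basisPath k '' S) ≤ J := by
    rw [TwoSidedIdeal.span_le]
    rintro _ ⟨z, hz, rfl⟩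
    have : basisPath k z ∈ I := hS ▸ TwoSidedIdeal.subset_span ⟨z, hz, rfl⟩
    exact (TwoSidedIdeal.mem_mk' ..).2 (Submodule.subset_span ⟨this, z, rfl⟩)
  exact (TwoSidedIdeal.mem_mk' ..).1 (hJ (hS ▸ hx))

/-- A monomial ideal contains every path that occurs in one of its elements. -/
theorem IsMonomial.basisPath_mem (hI : IsMonomial I) {x : PathAlgebra k V} (hx : x ∈ I)
    {z : QuiverPath V} (hz : coeff z x ≠ 0) : basisPath k z ∈ I := by
  obtain ⟨-, S, hS⟩ := hI
  replace hx := mem_pathSpan_of_mem_span hS hx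
  contrapose! hz
  induction hx using Submodule.span_induction with
  | zero => exact map_zero _
  | add x y _ _ hx hy => rw [map_add, hx, hy, add_zero]
  | smul c x _ hx => rw [map_smul, hx, smul_zero]
  | mem x hx =>
    obtain ⟨hx, z', rfl⟩ := hx
    refine coeff_basisPath_of_ne ?_
    rintro rfl
    exact hz hx

theorem IsMonomial.exists_length_le (hI : IsMonomial I) :
    ∃ t : ℕ, ∀ (a b : V) (p : Quiver.Path a b), t ≤ p.length → ofPath k p ∈ I := by
  obtain ⟨⟨t, -, ht, -⟩, -⟩ := hI
  refine ⟨t, fun a b p hp => ?_⟩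
  obtain ⟨c, q, r, hq, rfl⟩ : ∃ (c : V) (q : Quiver.Path a c) (r : Quiver.Path c b),
      r.length = t ∧ p = q.comp r := by
    clear ht
    induction t generalizing a b with
    | zero => exact ⟨b, p, .nil, rfl, rfl⟩
    | succ t ih =>
      cases p with
      | nil => simp at hp
      | cons p e =>
        obtain ⟨c, q, r, hr, rfl⟩ := ih _ _ p (by simpa using hp)
        exact ⟨c, q, r.cons e, by simp [hr], rfl⟩
  rw [← ofPath_mul]
  exact I.mul_mem_left _ _ (ht (TwoSidedIdeal.subset_span ⟨_, _, r, hq, rfl⟩))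

/-! ### Minimal paths in `I` along a cycle. -/

/-- Starting from a cycle `u` no cyclic shift of which lies in `I`, there are a path `p` and a
cyclic shift `u'` of `u` such that `u' p = p u` lies in `I`, but no proper right factor of it does. -/
theorem IsMonomial.exists_minimal_comp_mem (hI : IsMonomial I) {a b : V} {x : Quiver.Path a a}
    {u : Quiver.Path b b} (hx : 1 ≤ x.length) (hu : x.IsCyclicShift u)
    (hxI : ∀ (c : V) (y : Quiver.Path c c), x.IsCyclicShift y → ofPath k y ∉ I) :
    ∃ (c : V) (p : Quiver.Path c b) (u' : Quiver.Path c c), x.IsCyclicShift u' ∧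
      u'.comp p = p.comp u ∧ ofPath k (p.comp u) ∈ I ∧
      ∀ (d : V) (r : Quiver.Path c d) (s : Quiver.Path d b), p.comp u = r.comp s →
        1 ≤ r.length → ofPath k s ∉ I := by
  by_contra! H
  -- Without a minimal path, `p` could be prolonged backwards around the cycle forever while `p u`
  -- stays outside `I`.
  have key : ∀ n : ℕ, ∃ (c : V) (p : Quiver.Path c b) (u' : Quiver.Path c c),
      p.length = n ∧ x.IsCyclicShift u' ∧ u'.comp p = p.comp u ∧ ofPath k (p.comp u) ∉ I := by
    intro n
    induction n with
    | zero => exact ⟨b, .nil, u, rfl, hu, by simp, by simpa using hxI b u hu⟩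
    | succ n ih =>
      obtain ⟨c, p, u', hp, hu', hpu, hpI⟩ := ih
      have hlen := hu'.length_eq
      cases u' with
      | nil => simp at hlen; omega
      | @cons d _ s e =>
        have heq : (e.toPath.comp s).comp (e.toPath.comp p) = (e.toPath.comp p).comp u := by
          rw [Quiver.Path.comp_assoc, Quiver.Path.comp_assoc, ← hpu,
            ← Quiver.Path.comp_toPath_eq_cons, Quiver.Path.comp_assoc]
        refine ⟨d, e.toPath.comp p, e.toPath.comp s, by simp [hp, add_comm],
          hu'.rotate_arrow, heq, fun hmem => ?_⟩
        -- A proper right factor `q` of `e p u` is a right factor of `p u`, so `q ∈ I` would force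
        -- `p u ∈ I`.
        obtain ⟨f, r, q, hrq, hr, hq⟩ := H d _ _ hu'.rotate_arrow heq hmem
        rw [Quiver.Path.comp_assoc] at hrq
        refine hpI ?_
        rcases Quiver.Path.exists_of_comp_eq_comp _ _ _ _ hrq with ⟨t, ht, -⟩ | ⟨t, ht, ht'⟩
        · rw [ht, ← ofPath_mul]
          exact I.mul_mem_left _ _ hq
        · have := congrArg Quiver.Path.length ht'
          rw [Quiver.Path.length_comp, Quiver.Path.length_toPath] at this
          have h0 : t.length = 0 := by omega
          obtain rfl := t.eq_of_length_zero h0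
          obtain rfl := t.eq_nil_of_length_zero h0
          rw [Quiver.Path.nil_comp] at ht
          rwa [← ht]
  obtain ⟨t, ht⟩ := hI.exists_length_le
  obtain ⟨c, p, u', hp, -, -, h⟩ := key t
  exact h (ht _ _ _ (by simp [hp]))

/-! ### Projection onto the paths with a given right factor. -/

open Classical in
/-- The projection of the path algebra onto the span of the paths with right factor `p`. -/
def projSuffix (k : Type u) [Field k] {V : Type v} [Quiver.{w} V] {c d : V}
    (p : Quiver.Path c d) : PathAlgebra k V →ₗ[k] PathAlgebra k V :=
  (Finsupp.linearCombination k fun z : QuiverPath V =>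
    if ∃ (a : V) (y : Quiver.Path a c), z = ⟨a, d, y.comp p⟩ then basisPath k z else 0 :
    (QuiverPath V →₀ k) →ₗ[k] PathAlgebra k V)

open Classical in
theorem projSuffix_basisPath {c d : V} (p : Quiver.Path c d) (z : QuiverPath V) :
    projSuffix k p (basisPath k z) =
      if ∃ (a : V) (y : Quiver.Path a c), z = ⟨a, d, y.comp p⟩ then basisPath k z else 0 := by
  unfold projSuffix basisPath
  erw [Finsupp.linearCombination_single, one_smul]
  congr

theorem projSuffix_comp {a c d : V} (p : Quiver.Path c d) (y : Quiver.Path a c) :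
    projSuffix k p (ofPath k (y.comp p)) = ofPath k (y.comp p) := by
  unfold ofPath
  rw [projSuffix_basisPath, if_pos ⟨a, y, rfl⟩]

theorem projSuffix_mul_ofPath {c d : V} (p : Quiver.Path c d) (x : PathAlgebra k V) :
    projSuffix k p (x * ofPath k p) = x * ofPath k p := by
  induction x using induction_on with
  | zero => rw [zero_mul, map_zero]
  | add x y hx hy => rw [add_mul, map_add, hx, hy]
  | @smul e a b q =>
    rw [Algebra.smul_mul_assoc, map_smul]
    congr 1
    by_cases h : b = c
    · subst h
      rw [ofPath_mul, projSuffix_comp]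
    · rw [ofPath_mul_of_ne _ _ h, map_zero]

theorem exists_projSuffix_eq_mul {c d : V} (p : Quiver.Path c d) (x : PathAlgebra k V) :
    ∃ y, projSuffix k p x = y * ofPath k p := by
  induction x using induction_on with
  | zero => exact ⟨0, by rw [zero_mul, map_zero]⟩
  | add x y hx hy =>
    obtain ⟨x', hx⟩ := hx
    obtain ⟨y', hy⟩ := hy
    exact ⟨x' + y', by rw [map_add, hx, hy, add_mul]⟩
  | @smul e a b q =>
    unfold ofPath
    rw [map_smul, projSuffix_basisPath]
    split_ifs with h
    · obtain ⟨a', y, h⟩ := h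
      refine ⟨e • ofPath k y, ?_⟩
      rw [h, Algebra.smul_mul_assoc]
      exact congrArg (e • ·) (ofPath_mul y p).symm
    · exact ⟨0, by rw [smul_zero, zero_mul]⟩

theorem IsMonomial.projSuffix_mem (hI : IsMonomial I) {c d : V} (p : Quiver.Path c d)
    {x : PathAlgebra k V} (hx : x ∈ I) : projSuffix k p x ∈ I := by
  obtain ⟨s, hs, hxs⟩ := exists_finset_eq_sum x
  rw [hxs, map_sum]
  refine sum_mem fun z hz => ?_
  rw [map_smul, projSuffix_basisPath]
  refine smul_mem _ ?_
  split_ifs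
  · exact hI.basisPath_mem hx ((hs z).1 hz)
  · exact zero_mem _

/-- If `p q ∈ I` and no `s q` with `s` a proper right factor of `p` lies in `I`, then the
projection onto the paths with right factor `p` is linear on the left annihilator of `q`
modulo `I`. -/
theorem IsMonomial.projSuffix_mul (hI : IsMonomial I) {c d e : V} {p : Quiver.Path c d}
    {q : Quiver.Path d e}
    (hp : ∀ (f : V) (r : Quiver.Path c f) (s : Quiver.Path f d), p = r.comp s →
        1 ≤ r.length → ofPath k (s.comp q) ∉ I)
    (y : PathAlgebra k V) {x : PathAlgebra k V} (hx : x * ofPath k q ∈ I) :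
    projSuffix k p (y * x) = y * projSuffix k p x := by
  obtain ⟨s, hs, hxs⟩ := exists_finset_eq_sum x
  have hz : ∀ z ∈ s, projSuffix k p (y * basisPath k z) = y * projSuffix k p (basisPath k z) := by
    rintro ⟨a, b, z⟩ hz
    induction y using induction_on with
    | zero => rw [zero_mul, zero_mul, map_zero]
    | add y y' hy hy' => rw [add_mul, add_mul, map_add, hy, hy']
    | @smul l a' b' y =>
      rw [Algebra.smul_mul_assoc, Algebra.smul_mul_assoc, map_smul]
      congr 1
      rw [projSuffix_basisPath p ⟨a, b, z⟩]
      change projSuffix k p (ofPath k y * ofPath k z) = _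
      split_ifs with h
      · obtain ⟨f, t, h⟩ := h
        obtain rfl : a = f := congrArg Sigma.fst h
        obtain rfl : b = d := congrArg (fun z : QuiverPath V => z.2.1) h
        simp at h
        subst h
        change _ = ofPath k y * ofPath k _
        rw [← ofPath_mul, ← mul_assoc, projSuffix_mul_ofPath]
      · rw [mul_zero]
        by_cases hb : b' = a
        · subst hb
          rw [ofPath_mul]
          unfold ofPath
          rw [projSuffix_basisPath, if_neg]
          rintro ⟨f, t, h'⟩
          obtain rfl : a' = f := congrArg Sigma.fst h'
          obtain rfl : b = d := congrArg (fun z : QuiverPath V => z.2.1) h'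
          simp at h'
          -- Linearity could only fail if `y z` ends in `p` while `z` does not. Then `z` is a proper
          -- right factor of `p`, and `z q ∈ I` because `z` occurs in `x`; this contradicts `hp`.
          rcases Quiver.Path.exists_of_comp_eq_comp _ _ _ _ h' with ⟨r, rfl, -⟩ | ⟨r, hr, -⟩
          · exact h ⟨_, r, rfl⟩
          · refine hp _ r z hr ?_ ?_
            · by_contra h0
              replace h0 : r.length = 0 := by omega
              obtain rfl := r.eq_of_length_zero h0
              obtain rfl := r.eq_nil_of_length_zero h0
              exact h ⟨_, .nil, by rw [hr, Quiver.Path.nil_comp, Quiver.Path.nil_comp]⟩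
            · refine hI.basisPath_mem hx ?_
              rw [coeff_mul_ofPath]
              exact (hs _).1 hz
        · rw [ofPath_mul_of_ne _ _ hb, map_zero]
  rw [hxs, Finset.mul_sum, map_sum, map_sum, Finset.mul_sum]
  refine Finset.sum_congr rfl fun z hzs => ?_
  rw [Algebra.mul_smul_comm, map_smul, map_smul, Algebra.mul_smul_comm, hz z hzs]

end

end PathAlgebra

/-! ### Projective dimension of principal left ideals. -/

section CyclicModule

variable {Λ : Type u} [Ring Λ]

/-- The left ideal generated by an element, as an object of the category of left modules. -/
abbrev cyclicModule (a : Λ) : ModuleCat.{u} Λ :=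
  ModuleCat.of Λ (LinearMap.range (LinearMap.toSpanSingleton Λ Λ a))

/-- If `a` annihilates `b` from the left and `Λ a` is a direct summand of the left annihilator
of `b`, then the projective dimension of `Λ a` is less than that of `Λ b`, unless the latter
is projective. -/
theorem hasProjectiveDimensionLT_cyclicModule {a b : Λ} (hab : a * b = 0) (σ : Λ →+ Λ)
    (hσ : ∀ y x, x * b = 0 → σ (y * x) = y * σ x) (hσa : σ a = a)
    (hσr : ∀ x, ∃ y, σ x = y * a) (n : ℕ)
    (h : HasProjectiveDimensionLT (cyclicModule b) (n + 2)) :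
    HasProjectiveDimensionLT (cyclicModule a) (n + 1) := by
  let f := (LinearMap.toSpanSingleton Λ Λ b).rangeRestrict
  have hf : Function.Surjective f := LinearMap.surjective_rangeRestrict _
  have hker : ∀ x : Λ, x ∈ LinearMap.ker f ↔ x * b = 0 := fun x => by
    rw [LinearMap.ker_rangeRestrict, LinearMap.mem_ker, LinearMap.toSpanSingleton_apply,
      smul_eq_mul]
  have hproj : Projective (ModuleCat.of Λ Λ) := (IsProjective.iff_projective Λ).1 inferInstance
  -- The kernel is a first syzygy of `Λ b`, which lowers the bound by one; a retract inherits it.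
  have hX₁ : HasProjectiveDimensionLT (ModuleCat.of Λ (LinearMap.ker f)) (n + 1) :=
    (LinearMap.shortExact_shortComplexKer hf).hasProjectiveDimensionLT_X₁ (n + 1)
      (inferInstanceAs (HasProjectiveDimensionLT (ModuleCat.of Λ Λ) (n + 1))) h
  let ι : LinearMap.range (LinearMap.toSpanSingleton Λ Λ a) →ₗ[Λ] LinearMap.ker f :=
    Submodule.inclusion (by
      rintro _ ⟨y, rfl⟩
      rw [hker, LinearMap.toSpanSingleton_apply, smul_eq_mul, mul_assoc, hab, mul_zero])
  let ρ : LinearMap.ker f →ₗ[Λ] LinearMap.range (LinearMap.toSpanSingleton Λ Λ a) :=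
    { toFun := fun x => ⟨σ x, by
        obtain ⟨y, hy⟩ := hσr x
        exact ⟨y, hy.symm⟩⟩
      map_add' := fun x y => Subtype.ext (map_add σ _ _)
      map_smul' := fun y x => Subtype.ext (hσ y x ((hker x).1 x.2)) }
  have hρ : ρ ∘ₗ ι = LinearMap.id := by
    ext ⟨_, y, rfl⟩
    change σ (y * a) = y * a
    rw [hσ y a hab, hσa]
  have hr : Retract (cyclicModule a) (ModuleCat.of Λ (LinearMap.ker f)) :=
    { i := ModuleCat.ofHom ι
      r := ModuleCat.ofHom ρ
      retract := by rw [← ModuleCat.ofHom_comp, hρ]; rfl }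
  exact hr.hasProjectiveDimensionLT (n + 1)

/-- If `Λ b` is projective, then the left annihilator of `b` is annihilated by an element
fixing `b`. -/
theorem exists_mul_eq_of_projective_cyclicModule {b : Λ}
    (h : HasProjectiveDimensionLT (cyclicModule b) 1) :
    ∃ y, y * b = b ∧ ∀ x, x * b = 0 → x * y = 0 := by
  have hP : Module.Projective Λ (LinearMap.range (LinearMap.toSpanSingleton Λ Λ b)) :=
    (IsProjective.iff_projective _).2 (projective_iff_hasProjectiveDimensionLT_one.2 h)
  obtain ⟨s, hs⟩ := Module.projective_lifting_property
    (LinearMap.toSpanSingleton Λ Λ b).rangeRestrict LinearMap.id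
    (LinearMap.surjective_rangeRestrict _)
  let b' : LinearMap.range (LinearMap.toSpanSingleton Λ Λ b) := ⟨b, 1, one_smul _ _⟩
  -- The element is the image of `b` under a section of `Λ → Λ b`; linearity of the section gives
  -- both properties.
  refine ⟨s b', congrArg Subtype.val (LinearMap.congr_fun hs b'), fun x hx => ?_⟩
  have : x • b' = 0 := Subtype.ext hx
  rw [← smul_eq_mul, ← map_smul, this, map_zero]

end CyclicModule

/-! ### Descent of projective dimension in the monomial algebra. -/

namespace PathAlgebra

noncomputable section

variable {k : Type u} [Field k] {V : Type v} [Quiver.{w} V] [Fintype V]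
  {I : TwoSidedIdeal (PathAlgebra k V)}

theorem mk_eq_zero {x : PathAlgebra k V} : I.ringCon.mk' x = 0 ↔ x ∈ I := by
  rw [← map_zero I.ringCon.mk', I.mem_iff]
  exact I.ringCon.eq

/-- `projSuffix` modulo a monomial ideal. -/
def IsMonomial.quotientProjSuffix (hI : IsMonomial I) {c d : V} (p : Quiver.Path c d) :
    I.ringCon.Quotient →+ I.ringCon.Quotient :=
  AddCon.lift I.ringCon.toAddCon
    (I.ringCon.mk'.toAddMonoidHom.comp (projSuffix k p).toAddMonoidHom) fun x y hxy => by
      have := hI.projSuffix_mem p ((I.rel_iff x y).1 hxy)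
      rw [map_sub, ← mk_eq_zero, map_sub, sub_eq_zero] at this
      exact this

theorem IsMonomial.quotientProjSuffix_mk (hI : IsMonomial I) {c d : V} (p : Quiver.Path c d)
    (x : PathAlgebra k V) :
    hI.quotientProjSuffix p (I.ringCon.mk' x) = I.ringCon.mk' (projSuffix k p x) := rfl

theorem IsMonomial.hasProjectiveDimensionLT_cyclicModule_ofPath (hI : IsMonomial I) {c d e : V}
    {p : Quiver.Path c d} {q : Quiver.Path d e} (hpq : ofPath k (p.comp q) ∈ I)
    (hmin : ∀ (f : V) (r : Quiver.Path c f) (s : Quiver.Path f e), p.comp q = r.comp s →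
      1 ≤ r.length → ofPath k s ∉ I) (n : ℕ)
    (h : HasProjectiveDimensionLT (cyclicModule (I.ringCon.mk' (ofPath k q))) (n + 2)) :
    HasProjectiveDimensionLT (cyclicModule (I.ringCon.mk' (ofPath k p))) (n + 1) := by
  have hmin' : ∀ (f : V) (r : Quiver.Path c f) (s : Quiver.Path f d), p = r.comp s →
      1 ≤ r.length → ofPath k (s.comp q) ∉ I := fun f r s hrs hr =>
    hmin f r (s.comp q) (by rw [hrs, Quiver.Path.comp_assoc]) hr
  refine hasProjectiveDimensionLT_cyclicModule ?_ (hI.quotientProjSuffix p) ?_ ?_ ?_ n h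
  · rw [← map_mul, ofPath_mul, mk_eq_zero]
    exact hpq
  · intro y x hx
    obtain ⟨y, rfl⟩ := I.ringCon.mk'_surjective y
    obtain ⟨x, rfl⟩ := I.ringCon.mk'_surjective x
    rw [← map_mul, mk_eq_zero] at hx
    rw [← map_mul, hI.quotientProjSuffix_mk, hI.projSuffix_mul hmin' y hx, map_mul,
      hI.quotientProjSuffix_mk]
  · rw [hI.quotientProjSuffix_mk]
    have := projSuffix_comp (k := k) p .nil
    rw [Quiver.Path.nil_comp] at this
    rw [this]
  · intro x
    obtain ⟨x, rfl⟩ := I.ringCon.mk'_surjective x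
    obtain ⟨y, hy⟩ := exists_projSuffix_eq_mul p x
    exact ⟨I.ringCon.mk' y, by rw [hI.quotientProjSuffix_mk, hy, map_mul]⟩

/-- Projectivity would give `y` with `y q = q` and `p y = 0` in `Λ`. As `q ≠ 0`, the trivial path
has coefficient `1` in `y`, so `p` occurs in `p y` and must lie in `I`. -/
theorem IsMonomial.not_projective_cyclicModule_ofPath (hI : IsMonomial I) {c d e : V}
    {p : Quiver.Path c d} {q : Quiver.Path d e} (hpq : ofPath k (p.comp q) ∈ I)
    (hp : ofPath k p ∉ I) (hq : ofPath k q ∉ I) :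
    ¬ HasProjectiveDimensionLT (cyclicModule (I.ringCon.mk' (ofPath k q))) 1 := by
  intro h
  obtain ⟨y, hyq, hy⟩ := exists_mul_eq_of_projective_cyclicModule h
  obtain ⟨y, rfl⟩ := I.ringCon.mk'_surjective y
  specialize hy (I.ringCon.mk' (ofPath k p)) (by rw [← map_mul, ofPath_mul, mk_eq_zero]; exact hpq)
  rw [← map_mul, mk_eq_zero] at hy
  rw [← sub_eq_zero, ← map_mul, ← map_sub, mk_eq_zero] at hyq
  have h1 : coeff ⟨d, d, .nil⟩ y = 1 := by
    by_contra h1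
    refine hq (hI.basisPath_mem hyq ?_)
    have := coeff_mul_ofPath y .nil q
    rw [Quiver.Path.nil_comp] at this
    rw [map_sub, this]
    unfold ofPath
    rw [coeff_basisPath_self]
    exact sub_ne_zero.2 h1
  refine hp (hI.basisPath_mem hy ?_)
  have := coeff_ofPath_mul y p .nil
  rw [Quiver.Path.comp_nil] at this
  rw [this, h1]
  exact one_ne_zero

/-- The descent replaces `u` by another rotation `u'`, so the induction runs over all rotations at
once. -/
theorem IsMonomial.not_hasProjectiveDimensionLT_of_cycle (hI : IsMonomial I) {a : V}
    {x : Quiver.Path a a} (hx : 1 ≤ x.length)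
    (hxI : ∀ (c : V) (y : Quiver.Path c c), x.IsCyclicShift y → ofPath k y ∉ I) (n : ℕ) :
    ∀ (b : V) (u : Quiver.Path b b), x.IsCyclicShift u →
      ¬ HasProjectiveDimensionLT (cyclicModule (I.ringCon.mk' (ofPath k u))) (n + 1) := by
  induction n with
  | zero =>
    intro b u hu
    obtain ⟨c, p, u', hu', hpu, hmem, hmin⟩ := hI.exists_minimal_comp_mem hx hu hxI
    exact hI.not_projective_cyclicModule_ofPath hmem
      (hmin c u' p hpu.symm (hu'.length_eq ▸ hx)) (hxI b u hu)
  | succ n ih =>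
    intro b u hu h
    obtain ⟨c, p, u', hu', hpu, hmem, hmin⟩ := hI.exists_minimal_comp_mem hx hu hxI
    have h1 := hI.hasProjectiveDimensionLT_cyclicModule_ofPath hmem hmin n h
    refine ih c u' hu' (hI.hasProjectiveDimensionLT_cyclicModule_ofPath (hpu ▸ hmem)
      (hpu ▸ hmin) n ?_)
    -- Passing from `u` to `p` already gains one; the bound for `p` is relaxed so that the step to
    -- `u'` also applies when `n = 0`.
    exact hasProjectiveDimensionLT_of_ge _ (n + 1) (n + 2) (by omega)

end

end PathAlgebra

theorem proposition4 {k : Type u} [Field k] {V : Type v} [Quiver.{w} V] [Fintype V]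
    [∀ a b : V, Finite (a ⟶ b)] (I : TwoSidedIdeal (PathAlgebra k V))
    (hI : PathAlgebra.IsMonomial I) (hfin : HasFiniteGlobalDimension I.ringCon.Quotient)
    {a : V} (x : Quiver.Path a a) (hx : 1 ≤ x.length) :
    ∃ i : ℕ, 1 ≤ i ∧ i ≤ x.length ∧
      ∃ (b : V) (y : Quiver.Path b b), IsRotation x i y ∧ PathAlgebra.ofPath k y ∈ I := by
  by_contra! H
  have hxI : ∀ (c : V) (y : Quiver.Path c c), x.IsCyclicShift y → PathAlgebra.ofPath k y ∉ I := by
    rintro c y ⟨p, q, hpq, rfl⟩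
    have hlen := congrArg Quiver.Path.length hpq
    rw [Quiver.Path.length_comp] at hlen
    cases q with
    -- Moving all of `x` would be index `x.length + 1`, out of range; the result is `x` itself,
    -- which has index `1`.
    | nil =>
      rw [Quiver.Path.comp_nil] at hpq
      subst hpq
      rw [Quiver.Path.nil_comp]
      exact H 1 le_rfl hx a x ⟨.nil, x, rfl, by simp, rfl⟩
    | cons q e =>
      rw [Quiver.Path.length_cons] at hlen
      exact H (p.length + 1) (by omega) (by omega) c _ ⟨p, q.cons e, rfl, hpq, rfl⟩
  have hpd := hfin (cyclicModule (I.ringCon.mk' (PathAlgebra.ofPath k x)))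
    (Module.Finite.range _)
  obtain ⟨n, hn⟩ := (projectiveDimension_ne_top_iff _).1 hpd.ne
  exact hI.not_hasProjectiveDimensionLT_of_cycle hx hxI n a x ⟨.nil, x, by simp, rfl⟩ hn
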